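/- Let $K$ be a field, let $G$ be a finite simple graph on the vertex set $[n]=\{1,\dots,n\}$ with $n\ge 3$ and at least one edge, and let $S=K[x_1,\dots,x_n]$ with the standard grading. Let $$I_c(G)=\big((x_1\cdots x_n)/(x_ix_j):\ \{i,j\}\in E(G)\big)\subset S$$ be the complementary edge ideal of $G$. For a homogeneous ideal $I\subset S$ and $P\in\operatorname{Ass}(I)$, let $\operatorname{v}_P(I)$ be the least degree of a homogeneous element $f\in S$ such that $I:f=P$, and let $\operatorname{v}(I)=\min_{P\in\operatorname{Ass}(I)}\operatorname{v}_P(I)$. Let $\operatorname{reg} I=\max\{j-i:\beta_{i,j}(I)\ne0\}$ be the Castelnuovo–Mumford regularity, where $\beta_{i,j}(I)$ are the graded Betti numbers of $I$. The ideal $I$ has a linear resolution if, for some $d$, $\beta_{i,j}(I)\neq 0$ only for $j=i+d$; it has linear powers if $I^k$ has a linear resolution for all $k\ge1$. Let $tK_2$ be the disjoint union of $t$ copies of the complete graph on two vertices; $G=tK_2$ is understood up to isomorphism (so that $G$ has no isolated vertices). Then the following hold. (a) For all $k\ge1$, $$\operatorname{v}(I_c(G)^k)=\begin{cases}(n-2)k&\text{if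 } G=tK_2 \text{ with } t\ge2,\\ (n-2)k-1&\text{otherwise.}\end{cases}$$ (b) $\operatorname{v}(I_c(G)^k)<\operatorname{reg} I_c(G)^k$ for all $k\ge1$. (c) If $I_c(G)$ has linear powers, then $\operatorname{v}(I_c(G)^k)=\operatorname{reg} I_c(G)^k-1$ for all $k\ge1$. -/

import Mathlib

open MvPolynomial

/-- The complementary edge ideal `I_c(G)` of a simple graph `G` on the vertex set `Fin n`: the ideal
of `K[x_1, …, x_n]` generated by the monomials `(x_1 ⋯ x_n) / (x_i x_j)`, `{i, j}` an edge of `G`. -/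
noncomputable def complementaryEdgeIdeal (K : Type*) [Field K] {n : ℕ} (G : SimpleGraph (Fin n)) :
    Ideal (MvPolynomial (Fin n) K) :=
  Ideal.span {u | ∃ i j : Fin n, G.Adj i j ∧ u = ∏ l ∈ (Finset.univ \ {i, j} : Finset (Fin n)), X l}

/-- The graph `tK_2`, the disjoint union of `t` copies of the complete graph on two vertices. -/
def copiesK2 (t : ℕ) : SimpleGraph (Fin t × Fin 2) where
  Adj p q := p.1 = q.1 ∧ p.2 ≠ q.2
  symm := ⟨fun _ _ h => ⟨h.1.symm, h.2.symm⟩⟩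
  loopless := ⟨fun _ h => h.2 rfl⟩

/-- The local v-number of `I` at `P`: the least degree of a homogeneous polynomial `f` such that
`I : f = P`. -/
noncomputable def localVNumber {K : Type*} [Field K] {n : ℕ}
    (I P : Ideal (MvPolynomial (Fin n) K)) : EReal :=
  ⨅ (d : ℕ) (_ : ∃ f : MvPolynomial (Fin n) K, f.IsHomogeneous d ∧
    Submodule.colon I {f} = P), (d : EReal)

/-- The v-number of `I`: the minimum of the local v-numbers at the associated primes of `I`. -/
noncomputable def vNumber {K : Type*} [Field K] {n : ℕ}
    (I : Ideal (MvPolynomial (Fin n) K)) : EReal :=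
  ⨅ P ∈ associatedPrimes (MvPolynomial (Fin n) K) (MvPolynomial (Fin n) K ⧸ I), localVNumber I P

/-- A minimal graded free resolution `⋯ → F_2 → F_1 → F_0 → I → 0` of an ideal `I` of the standard
graded polynomial ring `S = K[x_1, …, x_n]`. The module `F_i` is free of finite rank `rank i`, with a
homogeneous basis whose `a`-th element has degree `deg i a`, so that
`F_i = ⨁ a, S(-deg i a)`. The map `F_0 → I` sends the `a`-th basis element to `gen a`, and
`F_{i+1} → F_i` is given by the matrix `diff i`. -/
structure MinimalGradedFreeResolution {K : Type*} [Field K] {n : ℕ}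
    (I : Ideal (MvPolynomial (Fin n) K)) where
  rank : ℕ → ℕ
  deg : (i : ℕ) → Fin (rank i) → ℕ
  gen : Fin (rank 0) → MvPolynomial (Fin n) K
  diff : (i : ℕ) → Matrix (Fin (rank i)) (Fin (rank (i + 1))) (MvPolynomial (Fin n) K)
  gen_homogeneous : ∀ a, (gen a).IsHomogeneous (deg 0 a)
  diff_homogeneous : ∀ i a b, diff i a b ≠ 0 →
    ∃ m : ℕ, deg i a + m = deg (i + 1) b ∧ (diff i a b).IsHomogeneous m
  span_gen : Ideal.span (Set.range gen) = I
  exact_zero : Function.Exact (diff 0).mulVecLin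
    (Fintype.linearCombination (MvPolynomial (Fin n) K) gen)
  exact_succ : ∀ i, Function.Exact (diff (i + 1)).mulVecLin (diff i).mulVecLin
  minimal : ∀ i a b, diff i a b ∈ idealOfVars (Fin n) K

/-- The graded Betti number `β_{i,j}(I)`: the number of basis elements of degree `j` of the `i`-th
module in the minimal graded free resolution of `I`. That resolution is unique up to isomorphism, so
that the supremum is over a single value. -/
noncomputable def gradedBetti {K : Type*} [Field K] {n : ℕ}
    (I : Ideal (MvPolynomial (Fin n) K)) (i j : ℕ) : ℕ∞ :=
  ⨆ F : MinimalGradedFreeResolution I, Set.encard {a : Fin (F.rank i) | F.deg i a = j}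

/-- The Castelnuovo–Mumford regularity `reg I = max {j - i : β_{i,j}(I) ≠ 0}`. -/
noncomputable def regularity {K : Type*} [Field K] {n : ℕ}
    (I : Ideal (MvPolynomial (Fin n) K)) : EReal :=
  ⨆ (i : ℕ) (j : ℕ) (_ : gradedBetti I i j ≠ 0), ((j : EReal) - (i : EReal))

/-- `I` has a linear resolution: for some `d`, the only nonzero graded Betti numbers of `I` are the
`β_{i,i+d}(I)`. -/
def HasLinearResolution {K : Type*} [Field K] {n : ℕ}
    (I : Ideal (MvPolynomial (Fin n) K)) : Prop :=
  ∃ d : ℕ, ∀ i j : ℕ, gradedBetti I i j ≠ 0 → j = i + d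

/-- `I` has linear powers: all powers `I^k`, `k ≥ 1`, have a linear resolution. -/
def HasLinearPowers {K : Type*} [Field K] {n : ℕ}
    (I : Ideal (MvPolynomial (Fin n) K)) : Prop :=
  ∀ k : ℕ, 1 ≤ k → HasLinearResolution (I ^ k)

/-!
Write `I = I_c(G)`. The power `I^k` is generated by monomials of degree `D = (n - 2) k`, whose
exponent vectors form the set `powerExponents G k`.

*Lower bound for the v-number.* If `I^k : f` is prime, it contains `I^k`, hence a monomial, hence a
variable `x`. As `x f` is a nonzero element of `I^k`, the degree of `f` is at least `D - 1`
(`le_vNumber_complementaryEdgeIdeal_pow`). If `G` is a disjoint union of at least two edges, every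
generator of `I^k` has equal exponents at the two ends of each edge, and the prime contains variables
`x` and `y` belonging to different edges. A polynomial `f` of degree `D - 1` with `x f` and `y f` in
`I^k` would have monomials that are unbalanced only at the edge of `x` and only at the edge of `y`;
so the degree of `f` is at least `D` (`le_vNumber_of_matching`).

*Upper bound.* Let `H` be a set of vertices and `W ⊆ H` a set that no edge contains, such that
removing any vertex of `W` from `H` leaves a subset of an edge. Let `f` be the product of the
variables outside `H` with the `(k - 1)`-st power of a generator of `I` containing exactly one variable
of `W`. Each variable of `W` multiplies `f` into `I^k`, and every generator of `I^k` has total exponent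
at least `k` on `W`, while `f` has total exponent `k - 1`; so `I^k : f = (x_w : w ∈ W)`
(`vNumber_pow_succ_le`). If some vertex is isolated or has two neighbours, there is such an `H` with
three elements, which gives degree `D - 1`; otherwise `G` is a disjoint union of edges, and two ends of
different edges give degree `D`.

*Regularity.* Minimal graded free resolutions exist: one covers the graded module of syzygies found so
far by a homogeneous generating family of least cardinality, again and again
(`exists_minimalGradedFreeResolution`). The first family can be chosen among the monomial generators,
so `β_{0,D}(I^k) ≠ 0` and `reg I^k ≥ D`. For a disjoint union of at least two edges, the balance of
the exponents shows that there are no linear syzygies, so `β_{1,j}(I^k) ≠ 0` for some `j ≥ D + 2`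
(`IsPartnerMap.exists_gradedBetti_one_ne_zero`); thus `reg I^k > D`, and `I` does not have linear
powers. Linear powers force `reg I^k = D`. The uniqueness of minimal resolutions plays no role.
-/

/-! ### Graded free modules and minimal generators -/

section GradedFree

variable {K : Type*} [Field K] {n : ℕ}

/-- The part of degree `D` of a polynomial regarded as an element of the shifted free module
`S(-s)`: the homogeneous component of degree `D - s`, which is `0` if `D < s`. -/
noncomputable def shiftedComponent (s D : ℕ) :
    MvPolynomial (Fin n) K →ₗ[K] MvPolynomial (Fin n) K :=
  if s ≤ D then homogeneousComponent (D - s) else 0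

theorem shiftedComponent_self (s : ℕ) (p : MvPolynomial (Fin n) K) :
    shiftedComponent s s p = C (coeff 0 p) := by
  simp [shiftedComponent]

theorem shiftedComponent_isHomogeneous (s D : ℕ) (p : MvPolynomial (Fin n) K)
    (h : shiftedComponent s D p ≠ 0) :
    ∃ m : ℕ, s + m = D ∧ (shiftedComponent s D p).IsHomogeneous m := by
  by_cases hs : s ≤ D
  · refine ⟨D - s, by omega, ?_⟩
    simp only [shiftedComponent, if_pos hs]
    exact homogeneousComponent_isHomogeneous _ _
  · simp [shiftedComponent, hs] at h

theorem sum_shiftedComponent (s M : ℕ) (p : MvPolynomial (Fin n) K) (hM : s + p.totalDegree < M) :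
    ∑ D ∈ Finset.range M, shiftedComponent s D p = p := by
  obtain ⟨N, rfl⟩ : ∃ N, M = s + N := ⟨M - s, by omega⟩
  rw [Finset.sum_range_add]
  have h1 : ∑ D ∈ Finset.range s, shiftedComponent s D p = 0 := by
    refine Finset.sum_eq_zero fun D hD => ?_
    have : ¬ s ≤ D := by simpa using hD
    simp [shiftedComponent, this]
  rw [h1, zero_add]
  conv_rhs => rw [← sum_homogeneousComponent p]
  symm
  have h2 : ∀ i, shiftedComponent s (s + i) p = homogeneousComponent i p := fun i => by
    simp [shiftedComponent]
  simp only [h2]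
  refine Finset.sum_subset (by simp; omega) fun i _ hi => ?_
  exact homogeneousComponent_eq_zero _ _ (by simp at hi; omega)

/-- Multiplication by a homogeneous polynomial `q`, as a degree-preserving map
`S(-s') → S(-s)`, commutes with taking graded parts. -/
theorem shiftedComponent_mul (s s' D : ℕ) (p q : MvPolynomial (Fin n) K)
    (hq : q ≠ 0 → ∃ m : ℕ, s + m = s' ∧ q.IsHomogeneous m) :
    shiftedComponent s D (p * q) = shiftedComponent s' D p * q := by
  by_cases h0 : q = 0
  · simp [h0]
  obtain ⟨m, rfl, hm⟩ := hq h0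
  induction p using MvPolynomial.induction_on' with
  | add p₁ p₂ h₁ h₂ => simp only [add_mul, map_add, h₁, h₂]
  | monomial u a =>
    have hu : (monomial u a : MvPolynomial (Fin n) K).IsHomogeneous u.degree :=
      isHomogeneous_monomial a rfl
    have hp : (monomial u a * q).IsHomogeneous (u.degree + m) := hu.mul hm
    by_cases hs : s ≤ D
    · by_cases hs' : s + m ≤ D
      · simp only [shiftedComponent, if_pos hs, if_pos hs']
        rw [homogeneousComponent_of_mem hp, homogeneousComponent_of_mem hu]
        by_cases hd : D - (s + m) = u.degree
        · rw [if_pos hd, if_pos (by omega)]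
        · rw [if_neg hd, if_neg (by omega), zero_mul]
      · simp only [shiftedComponent, if_pos hs, if_neg hs']
        rw [homogeneousComponent_of_mem hp, if_neg (by omega)]
        simp
    · simp [shiftedComponent, if_neg hs, if_neg (show ¬ s + m ≤ D by omega)]

/-- The part of degree `D` of an element of the graded free module `⨁ a, S(-deg a)`. -/
noncomputable def vectorComponent {r : ℕ} (deg : Fin r → ℕ) (D : ℕ)
    (v : Fin r → MvPolynomial (Fin n) K) : Fin r → MvPolynomial (Fin n) K :=
  fun a => shiftedComponent (deg a) D (v a)

/-- `v` is homogeneous of degree `D` in the graded free module `⨁ a, S(-deg a)`. -/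
def IsHomogeneousVector {r : ℕ} (deg : Fin r → ℕ) (D : ℕ)
    (v : Fin r → MvPolynomial (Fin n) K) : Prop :=
  ∀ a, v a ≠ 0 → ∃ m : ℕ, deg a + m = D ∧ (v a).IsHomogeneous m

theorem vectorComponent_isHomogeneousVector {r : ℕ} (deg : Fin r → ℕ) (D : ℕ)
    (v : Fin r → MvPolynomial (Fin n) K) : IsHomogeneousVector deg D (vectorComponent deg D v) :=
  fun a h => shiftedComponent_isHomogeneous (deg a) D (v a) h

theorem exists_sum_vectorComponent {r : ℕ} (deg : Fin r → ℕ)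
    (v : Fin r → MvPolynomial (Fin n) K) :
    ∃ M, ∑ D ∈ Finset.range M, vectorComponent deg D v = v := by
  refine ⟨∑ a, (deg a + (v a).totalDegree) + 1, ?_⟩
  ext1 a
  rw [Finset.sum_apply]
  refine sum_shiftedComponent _ _ _ (Nat.lt_succ_of_le ?_)
  exact Finset.single_le_sum (f := fun a => deg a + (v a).totalDegree) (fun _ _ => Nat.zero_le _)
    (Finset.mem_univ a)

/-- A graded submodule is generated by its homogeneous elements. -/
theorem span_isHomogeneousVector {r : ℕ} (deg : Fin r → ℕ)
    (N : Submodule (MvPolynomial (Fin n) K) (Fin r → MvPolynomial (Fin n) K))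
    (hN : ∀ v ∈ N, ∀ D, vectorComponent deg D v ∈ N) :
    Submodule.span (MvPolynomial (Fin n) K) {v | v ∈ N ∧ ∃ D, IsHomogeneousVector deg D v} = N := by
  refine le_antisymm (Submodule.span_le.2 fun v hv => hv.1) fun v hv => ?_
  obtain ⟨M, hM⟩ := exists_sum_vectorComponent deg v
  rw [← hM]
  exact Submodule.sum_mem _ fun D _ => Submodule.subset_span
    ⟨hN v hv D, D, vectorComponent_isHomogeneousVector deg D v⟩

/-- Syzygies of homogeneous elements form a graded submodule, stated for one coordinate of the
relation. -/
theorem sum_vectorComponent_mul_eq_zero {r : ℕ} (s : ℕ) (deg : Fin r → ℕ)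
    (q : Fin r → MvPolynomial (Fin n) K)
    (hq : ∀ b, q b ≠ 0 → ∃ m : ℕ, s + m = deg b ∧ (q b).IsHomogeneous m)
    (v : Fin r → MvPolynomial (Fin n) K) (hv : ∑ b, v b * q b = 0) (D : ℕ) :
    ∑ b, vectorComponent deg D v b * q b = 0 := by
  have := congrArg (shiftedComponent s D) hv
  rw [map_sum, map_zero] at this
  rw [← this]
  exact Finset.sum_congr rfl fun b _ => (shiftedComponent_mul s (deg b) D _ _ (hq b)).symm

/-- A generating family of least cardinality with members in `T` has no relation with a unit
coefficient. -/
theorem exists_minimal_generators {R M : Type*} [CommRing R] [AddCommGroup M] [Module R M]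
    (T : Set M) (hT : (Submodule.span R T).FG) :
    ∃ (r : ℕ) (g : Fin r → M), (∀ b, g b ∈ T) ∧
      Submodule.span R (Set.range g) = Submodule.span R T ∧
      ∀ v : Fin r → R, ∑ b, v b • g b = 0 → ∀ a, ¬ IsUnit (v a) := by
  classical
  have hex : ∃ (r : ℕ) (g : Fin r → M), (∀ b, g b ∈ T) ∧
      Submodule.span R (Set.range g) = Submodule.span R T := by
    obtain ⟨t, htT, ht⟩ := (Submodule.fg_span_iff_fg_span_finset_subset T).1 hT
    refine ⟨t.card, fun b => (t.equivFin.symm b : M), fun b => htT (t.equivFin.symm b).2, ?_⟩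
    rw [ht]
    congr 1
    ext x
    constructor
    · rintro ⟨b, rfl⟩
      exact (t.equivFin.symm b).2
    · intro hx
      exact ⟨t.equivFin ⟨x, hx⟩, by simp⟩
  obtain ⟨g, hgT, hg⟩ := Nat.find_spec hex
  refine ⟨Nat.find hex, g, hgT, hg, ?_⟩
  have hmin : ∀ m < Nat.find hex, _ := fun m hm => Nat.find_min hex hm
  generalize Nat.find hex = r at g hgT hg hmin
  intro v hv a ha
  obtain ⟨r, rfl⟩ : ∃ r', r = r' + 1 := ⟨r - 1, by have := a.pos; omega⟩
  refine hmin r (Nat.lt_succ_self r) ⟨fun b => g (a.succAbove b), fun b => hgT _, ?_⟩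
  rw [← hg]
  refine le_antisymm (Submodule.span_mono (by rintro _ ⟨b, rfl⟩; exact ⟨_, rfl⟩)) ?_
  rw [Submodule.span_le]
  rintro _ ⟨b, rfl⟩
  rcases Fin.eq_self_or_eq_succAbove a b with rfl | ⟨j, rfl⟩
  · rw [Fin.sum_univ_succAbove _ b] at hv
    obtain ⟨u, hu⟩ := ha
    have h1 : v b • g b ∈ Submodule.span R (Set.range fun j => g (b.succAbove j)) := by
      rw [eq_neg_of_add_eq_zero_left hv]
      exact Submodule.neg_mem _ (Submodule.sum_mem _ fun j _ =>
        Submodule.smul_mem _ _ (Submodule.subset_span ⟨j, rfl⟩))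
    rw [← hu] at h1
    have := Submodule.smul_mem _ (↑u⁻¹ : R) h1
    rwa [smul_smul, Units.inv_mul, one_smul] at this
  · exact Submodule.subset_span ⟨j, rfl⟩

theorem mem_idealOfVars_iff (p : MvPolynomial (Fin n) K) :
    p ∈ idealOfVars (Fin n) K ↔ coeff 0 p = 0 := by
  rw [← pow_one (idealOfVars (Fin n) K), mem_pow_idealOfVars_iff']
  constructor
  · exact fun h => h 0 (by simp)
  · intro h x hx
    have : x = 0 := by simpa [Finsupp.degree_eq_zero_iff] using hx
    rw [this, h]

/-- Graded syzygies with no unit coefficient have all coordinates in the maximal ideal: the part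
of degree `deg a` of a syzygy has a constant as its `a`-th coordinate. -/
theorem mem_idealOfVars_of_graded {r : ℕ} (deg : Fin r → ℕ)
    (N : Submodule (MvPolynomial (Fin n) K) (Fin r → MvPolynomial (Fin n) K))
    (hN : ∀ v ∈ N, ∀ D, vectorComponent deg D v ∈ N) (hu : ∀ v ∈ N, ∀ a, ¬ IsUnit (v a)) :
    ∀ v ∈ N, ∀ a, v a ∈ idealOfVars (Fin n) K := by
  intro v hv a
  rw [mem_idealOfVars_iff]
  by_contra h
  refine hu _ (hN v hv (deg a)) a ?_
  rw [vectorComponent, shiftedComponent_self]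
  exact (isUnit_iff_ne_zero.2 h).map C

end GradedFree

/-! ### Existence of minimal graded free resolutions -/

section Resolution

variable {K : Type*} [Field K] {n : ℕ}

variable (K n) in
/-- The state of the construction of a minimal graded free resolution after finitely many steps: the
last free module, and the graded submodule of it that the next free module has to cover. -/
structure ResolutionStage where
  rank : ℕ
  deg : Fin rank → ℕ
  syz : Submodule (MvPolynomial (Fin n) K) (Fin rank → MvPolynomial (Fin n) K)
  graded : ∀ v ∈ syz, ∀ D, vectorComponent deg D v ∈ syz
  minimal : ∀ v ∈ syz, ∀ a, v a ∈ idealOfVars (Fin n) K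

theorem ResolutionStage.exists_next (P : ResolutionStage K n) :
    ∃ (Q : ResolutionStage K n) (A : Matrix (Fin P.rank) (Fin Q.rank) (MvPolynomial (Fin n) K)),
      LinearMap.range A.mulVecLin = P.syz ∧ LinearMap.ker A.mulVecLin = Q.syz ∧
      ∀ a b, A a b ≠ 0 → ∃ m : ℕ, P.deg a + m = Q.deg b ∧ (A a b).IsHomogeneous m := by
  obtain ⟨r, g, hgT, hg, hmin⟩ := exists_minimal_generators
    {v | v ∈ P.syz ∧ ∃ D, IsHomogeneousVector P.deg D v}
    (IsNoetherian.noetherian (R := MvPolynomial (Fin n) K) _)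
  rw [span_isHomogeneousVector _ _ P.graded] at hg
  choose hgN deg hdeg using hgT
  let A : Matrix (Fin P.rank) (Fin r) (MvPolynomial (Fin n) K) := fun a b => g b a
  have hA : ∀ v, A.mulVecLin v = ∑ b, v b • g b := fun v => by
    ext1 a
    rw [Matrix.mulVecLin_apply]
    change ∑ b, A a b * v b = _
    simp [A, mul_comm]
  have hgr : ∀ v ∈ LinearMap.ker A.mulVecLin, ∀ D,
      vectorComponent deg D v ∈ LinearMap.ker A.mulVecLin := by
    intro v hv D
    rw [LinearMap.mem_ker, hA] at hv ⊢
    ext1 a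
    have h := congrFun hv a
    simp only [Finset.sum_apply, Pi.smul_apply, smul_eq_mul, Pi.zero_apply] at h ⊢
    exact sum_vectorComponent_mul_eq_zero (P.deg a) deg (fun b => g b a) (fun b => hdeg b a) v h D
  refine ⟨⟨r, deg, LinearMap.ker A.mulVecLin, hgr, mem_idealOfVars_of_graded deg _ hgr ?_⟩, A,
    ?_, rfl, fun a b => hdeg b a⟩
  · intro v hv
    rw [LinearMap.mem_ker, hA] at hv
    exact hmin v hv
  · rw [Matrix.range_mulVecLin, ← hg]
    rfl

/-- An ideal generated by a set `T` of homogeneous polynomials of the same degree `D` has a minimal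
graded free resolution whose generators are taken from `T`. -/
theorem exists_minimalGradedFreeResolution (I : Ideal (MvPolynomial (Fin n) K)) (D : ℕ)
    (T : Set (MvPolynomial (Fin n) K)) (hT : ∀ u ∈ T, u.IsHomogeneous D) (hI : Ideal.span T = I) :
    ∃ F : MinimalGradedFreeResolution I, (∀ a, F.gen a ∈ T) ∧ ∀ a, F.deg 0 a = D := by
  obtain ⟨r, g, hgT, hg, hmin⟩ := exists_minimal_generators (R := MvPolynomial (Fin n) K) T
    (IsNoetherian.noetherian _)
  have hL : ∀ v, Fintype.linearCombination (MvPolynomial (Fin n) K) g v = ∑ b, v b * g b :=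
    fun v => by simp [Fintype.linearCombination_apply]
  have hgr : ∀ v ∈ LinearMap.ker (Fintype.linearCombination (MvPolynomial (Fin n) K) g), ∀ E,
      vectorComponent (fun _ => D) E v ∈
        LinearMap.ker (Fintype.linearCombination (MvPolynomial (Fin n) K) g) := by
    intro v hv E
    rw [LinearMap.mem_ker, hL] at hv ⊢
    exact sum_vectorComponent_mul_eq_zero 0 (fun _ => D) g
      (fun b _ => ⟨D, zero_add D, hT _ (hgT b)⟩) v hv E
  let P₀ : ResolutionStage K n := ⟨r, fun _ => D, _, hgr, mem_idealOfVars_of_graded _ _ hgr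
    fun v hv => hmin v (by simpa [hL] using hv)⟩
  choose next A hrange hker hdeg using ResolutionStage.exists_next (K := K) (n := n)
  let stage : ℕ → ResolutionStage K n := fun i => Nat.rec P₀ (fun _ P => next P) i
  refine ⟨{
    rank := fun i => (stage i).rank
    deg := fun i => (stage i).deg
    gen := g
    diff := fun i => A (stage i)
    gen_homogeneous := fun a => hT _ (hgT a)
    diff_homogeneous := fun i => hdeg (stage i)
    span_gen := hg.trans hI
    exact_zero := ?_
    exact_succ := fun i => ?_
    minimal := fun i a b => ?_ }, hgT, fun _ => rfl⟩
  · rw [LinearMap.exact_iff]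
    exact (hrange P₀).symm
  · rw [LinearMap.exact_iff]
    exact (hker (stage i)).trans (hrange (stage (i + 1))).symm
  · have h : (A (stage i)).mulVecLin (Pi.single b 1) ∈ (stage i).syz := by
      rw [← hrange]
      exact ⟨_, rfl⟩
    simpa using (stage i).minimal _ h a

end Resolution

/-! ### Monomials in powers of the complementary edge ideal -/

section Monomials

variable {n : ℕ}

/-- The exponent vector of the squarefree monomial `∏ l ∉ H, x_l`. -/
noncomputable def complementExponent (H : Finset (Fin n)) : Fin n →₀ ℕ :=
  ∑ l ∈ Finset.univ \ H, Finsupp.single l 1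

theorem complementExponent_apply (H : Finset (Fin n)) (l : Fin n) :
    complementExponent H l = if l ∈ H then 0 else 1 := by
  simp [complementExponent, Finsupp.finsetSum_apply, Finsupp.single_apply, Finset.sum_ite_eq',
    ite_not]

theorem degree_complementExponent (H : Finset (Fin n)) :
    (complementExponent H).degree = n - H.card := by
  rw [complementExponent, map_sum]
  simp [Finset.card_sdiff]

theorem sum_complementExponent (H W : Finset (Fin n)) :
    ∑ w ∈ W, complementExponent H w = (W \ H).card := by
  simp only [complementExponent_apply, Finset.card_eq_sum_ones, Finset.sum_ite, Finset.sum_const_zero,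
    zero_add, Finset.sdiff_eq_filter]

/-- The exponent vectors of the products of `k` generators of the complementary edge ideal. -/
def powerExponents (G : SimpleGraph (Fin n)) : ℕ → Set (Fin n →₀ ℕ)
  | 0 => {0}
  | k + 1 => {s | ∃ u ∈ powerExponents G k, ∃ i j, G.Adj i j ∧ s = u + complementExponent {i, j}}

theorem monomial_add_complementExponent (K : Type*) [Field K] (u : Fin n →₀ ℕ)
    (H : Finset (Fin n)) : monomial (u + complementExponent H) (1 : K) =
      monomial u 1 * ∏ l ∈ Finset.univ \ H, X l := by
  rw [← one_mul (1 : K), ← monomial_mul, one_mul, complementExponent, monomial_sum_one]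
  rfl

theorem span_monomial_powerExponents (K : Type*) [Field K] (G : SimpleGraph (Fin n)) (k : ℕ) :
    Ideal.span ((fun s => monomial s (1 : K)) '' powerExponents G k) =
      complementaryEdgeIdeal K G ^ k := by
  induction k with
  | zero => simp [powerExponents]
  | succ k ih =>
    rw [pow_succ, ← ih, complementaryEdgeIdeal, Ideal.span_mul_span']
    congr 1
    ext p
    constructor
    · rintro ⟨_, ⟨u, hu, i, j, hij, rfl⟩, rfl⟩
      exact ⟨_, ⟨u, hu, rfl⟩, _, ⟨i, j, hij, rfl⟩, (monomial_add_complementExponent K u _).symm⟩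
    · rintro ⟨_, ⟨u, hu, rfl⟩, _, ⟨i, j, hij, rfl⟩, rfl⟩
      exact ⟨_, ⟨u, hu, i, j, hij, rfl⟩, monomial_add_complementExponent K u _⟩

theorem mem_complementaryEdgeIdeal_pow {K : Type*} [Field K] {G : SimpleGraph (Fin n)} {k : ℕ}
    {p : MvPolynomial (Fin n) K} :
    p ∈ complementaryEdgeIdeal K G ^ k ↔
      ∀ d ∈ p.support, ∃ s ∈ powerExponents G k, s ≤ d := by
  rw [← span_monomial_powerExponents, mem_ideal_span_monomial_image]

theorem monomial_mem_complementaryEdgeIdeal_pow {K : Type*} [Field K] {G : SimpleGraph (Fin n)}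
    {k : ℕ} {s : Fin n →₀ ℕ} :
    monomial s (1 : K) ∈ complementaryEdgeIdeal K G ^ k ↔ ∃ u ∈ powerExponents G k, u ≤ s := by
  classical
  simp [mem_complementaryEdgeIdeal_pow, support_monomial]

theorem nsmul_mem_powerExponents {G : SimpleGraph (Fin n)} {i j : Fin n} (h : G.Adj i j) (k : ℕ) :
    k • complementExponent {i, j} ∈ powerExponents G k := by
  induction k with
  | zero => simp [powerExponents]
  | succ k ih => exact ⟨_, ih, i, j, h, succ_nsmul _ _⟩

theorem degree_of_mem_powerExponents {G : SimpleGraph (Fin n)} {k : ℕ} {s : Fin n →₀ ℕ}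
    (hs : s ∈ powerExponents G k) : s.degree = (n - 2) * k := by
  induction k generalizing s with
  | zero => simp_all [powerExponents]
  | succ k ih =>
    obtain ⟨u, hu, i, j, hij, rfl⟩ := hs
    rw [map_add, ih hu, degree_complementExponent, Finset.card_pair hij.ne]
    ring

/-- Every generator of the complementary edge ideal omits only two variables, the ends of an edge;
so it contains a variable of `W` as soon as no edge contains `W`. -/
theorem le_sum_of_mem_powerExponents {G : SimpleGraph (Fin n)} {W : Finset (Fin n)}
    (hW : ∀ i j, G.Adj i j → ¬ W ⊆ {i, j}) {k : ℕ} {s : Fin n →₀ ℕ}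
    (hs : s ∈ powerExponents G k) : k ≤ ∑ w ∈ W, s w := by
  induction k generalizing s with
  | zero => exact Nat.zero_le _
  | succ k ih =>
    obtain ⟨u, hu, i, j, hij, rfl⟩ := hs
    simp only [Finsupp.add_apply, Finset.sum_add_distrib, sum_complementExponent]
    have h1 := ih hu
    have h2 : 0 < (W \ {i, j}).card := by
      rw [Finset.card_pos, Finset.sdiff_nonempty]
      exact hW i j hij
    omega

/-- If `σ` permutes the ends of every edge, as the partner map of a perfect matching does, then the
variables `x_l` and `x_{σ l}` have the same exponent in every product of generators. -/
theorem apply_eq_of_mem_powerExponents {G : SimpleGraph (Fin n)} {σ : Fin n → Fin n}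
    (hσ : ∀ i j l, G.Adj i j → (l ∈ ({i, j} : Finset (Fin n)) ↔ σ l ∈ ({i, j} : Finset (Fin n))))
    {k : ℕ} {s : Fin n →₀ ℕ} (hs : s ∈ powerExponents G k) (l : Fin n) : s l = s (σ l) := by
  induction k generalizing s with
  | zero => simp_all [powerExponents]
  | succ k ih =>
    obtain ⟨u, hu, i, j, hij, rfl⟩ := hs
    simp only [Finsupp.add_apply, complementExponent_apply, ih hu, hσ i j l hij]

end Monomials

/-! ### Bounds for the v-number -/

section VNumber

variable {K : Type*} [Field K] {n : ℕ}

theorem isPrime_span_X_image (W : Set (Fin n)) :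
    (Ideal.span (X '' W) : Ideal (MvPolynomial (Fin n) K)).IsPrime := by
  classical
  -- the ideal is the kernel of the map that sends the variables in `W` to zero
  let φ : MvPolynomial (Fin n) K →ₐ[K] MvPolynomial (Fin n) K :=
    aeval fun i => if i ∈ W then 0 else X i
  have hφ : Ideal.span (X '' W) = RingHom.ker φ.toRingHom := by
    refine le_antisymm (Ideal.span_le.2 ?_) fun p hp => ?_
    · rintro _ ⟨i, hi, rfl⟩
      simp [φ, RingHom.mem_ker, hi]
    · have h : (Ideal.Quotient.mkₐ K (Ideal.span (X '' W))).comp φ =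
          Ideal.Quotient.mkₐ K (Ideal.span (X '' W)) := by
        ext i
        by_cases hi : i ∈ W
        · simp only [AlgHom.comp_apply, φ, aeval_X, if_pos hi, map_zero]
          exact (Ideal.Quotient.eq_zero_iff_mem.2 (Ideal.subset_span (Set.mem_image_of_mem _ hi))).symm
        · simp [φ, hi]
      have h2 := DFunLike.congr_fun h p
      rw [AlgHom.comp_apply, show φ p = 0 from hp, map_zero] at h2
      exact Ideal.Quotient.eq_zero_iff_mem.1 h2.symm
  rw [hφ]
  exact RingHom.ker_isPrime _

theorem vNumber_le {I : Ideal (MvPolynomial (Fin n) K)} {f : MvPolynomial (Fin n) K} {d : ℕ}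
    (hf : f.IsHomogeneous d) (hP : (Submodule.colon I {f}).IsPrime) : vNumber I ≤ d := by
  refine (iInf₂_le (Submodule.colon I {f}) ?_).trans (iInf₂_le d ⟨f, hf, rfl⟩)
  refine ⟨hP, Ideal.Quotient.mk I f, ?_⟩
  have : Submodule.colon (⊥ : Submodule (MvPolynomial (Fin n) K) (MvPolynomial (Fin n) K ⧸ I))
      {Ideal.Quotient.mk I f} = Submodule.colon I {f} := by
    ext p
    rw [Submodule.mem_colon_singleton, Submodule.mem_colon_singleton, Submodule.mem_bot,
      ← Ideal.Quotient.eq_zero_iff_mem]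
    rfl
  rw [this, hP.radical]

theorem le_vNumber {I : Ideal (MvPolynomial (Fin n) K)} {c : ℕ}
    (h : ∀ (d : ℕ) (f : MvPolynomial (Fin n) K), f.IsHomogeneous d →
      (Submodule.colon I {f}).IsPrime → c ≤ d) : (c : EReal) ≤ vNumber I := by
  refine le_iInf₂ fun P hP => le_iInf₂ fun d hd => ?_
  obtain ⟨f, hf, rfl⟩ := hd
  exact_mod_cast h d f hf hP.isPrime

theorem exists_X_mem_of_monomial_mem {P : Ideal (MvPolynomial (Fin n) K)} (hP : P.IsPrime)
    {s : Fin n →₀ ℕ} (hs : monomial s (1 : K) ∈ P) : ∃ l, s l ≠ 0 ∧ X l ∈ P := by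
  rw [monomial_eq, C_1, one_mul, Finsupp.prod, hP.prod_mem_iff] at hs
  obtain ⟨l, hl, h⟩ := hs
  exact ⟨l, Finsupp.mem_support_iff.1 hl, hP.mem_of_pow_mem _ h⟩

theorem ne_zero_of_isPrime_colon {I : Ideal (MvPolynomial (Fin n) K)} {f : MvPolynomial (Fin n) K}
    (hP : (Submodule.colon I {f}).IsPrime) : f ≠ 0 := by
  rintro rfl
  exact hP.ne_top (by ext p; simp [Submodule.mem_colon_singleton])

theorem degree_eq_of_mem_support {f : MvPolynomial (Fin n) K} {d : ℕ} (hf : f.IsHomogeneous d)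
    {u : Fin n →₀ ℕ} (hu : u ∈ f.support) : u.degree = d := by
  by_contra h
  exact mem_support_iff.1 hu (hf.coeff_eq_zero h)

theorem exists_le_add_single {G : SimpleGraph (Fin n)} {k : ℕ} {f : MvPolynomial (Fin n) K}
    {l : Fin n} (h : X l ∈ Submodule.colon (complementaryEdgeIdeal K G ^ k) {f})
    {d : Fin n →₀ ℕ} (hd : d ∈ f.support) :
    ∃ s ∈ powerExponents G k, s ≤ d + Finsupp.single l 1 := by
  rw [Submodule.mem_colon_singleton, smul_eq_mul, mul_comm] at h
  refine mem_complementaryEdgeIdeal_pow.1 h _ ?_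
  rwa [mem_support_iff, coeff_mul_X, ← mem_support_iff]

theorem monomial_mem_colon {G : SimpleGraph (Fin n)} {k : ℕ} {s : Fin n →₀ ℕ}
    (hs : s ∈ powerExponents G k) (f : MvPolynomial (Fin n) K) :
    monomial s 1 ∈ Submodule.colon (complementaryEdgeIdeal K G ^ k) {f} := by
  rw [Submodule.mem_colon_singleton, smul_eq_mul]
  exact Ideal.mul_mem_right _ _ (monomial_mem_complementaryEdgeIdeal_pow.2 ⟨s, hs, le_rfl⟩)

/-- A prime colon ideal `I^k : f` contains a variable `x`, and `x f` is a nonzero element of `I^k`,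
which is generated in degree `(n - 2) k`. -/
theorem le_vNumber_complementaryEdgeIdeal_pow {G : SimpleGraph (Fin n)} (hG : G.edgeSet.Nonempty)
    (k : ℕ) : (((n - 2) * k - 1 : ℕ) : EReal) ≤ vNumber (complementaryEdgeIdeal K G ^ k) := by
  refine le_vNumber fun d f hf hP => ?_
  obtain ⟨e, he⟩ := hG
  induction e with | _ i j
  obtain ⟨l, -, hl⟩ := exists_X_mem_of_monomial_mem hP
    (monomial_mem_colon (nsmul_mem_powerExponents he k) f)
  obtain ⟨u, hu⟩ := support_nonempty.2 (ne_zero_of_isPrime_colon hP)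
  obtain ⟨s, hs, hsu⟩ := exists_le_add_single hl hu
  have h1 := Finsupp.degree_mono hsu
  rw [degree_of_mem_powerExponents hs, map_add, Finsupp.degree_single,
    degree_eq_of_mem_support hf hu] at h1
  omega

/-- For the disjoint union of at least two edges, a prime colon ideal `I^k : f` contains variables
`x` and `y` from two different edges. If `f` had degree `(n - 2) k - 1`, then `x f` and `y f` would
be combinations of products of generators, in which partners have equal exponents; this is
impossible for both at once. -/
theorem le_vNumber_of_matching {G : SimpleGraph (Fin n)} {σ : Fin n → Fin n}
    (hσ : ∀ i j l, G.Adj i j → (l ∈ ({i, j} : Finset (Fin n)) ↔ σ l ∈ ({i, j} : Finset (Fin n))))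
    (hadj : ∀ l, G.Adj l (σ l)) (hG : G.edgeSet.Nonempty)
    (k : ℕ) : (((n - 2) * k : ℕ) : EReal) ≤ vNumber (complementaryEdgeIdeal K G ^ k) := by
  refine le_vNumber fun d f hf hP => ?_
  by_contra! hd
  -- the `k`-th power of the generator that omits an edge lies in the colon ideal
  have hex : ∀ i, ∃ l, l ∉ ({i, σ i} : Finset (Fin n)) ∧
      X l ∈ Submodule.colon (complementaryEdgeIdeal K G ^ k) {f} := by
    intro i
    obtain ⟨l, h, hl⟩ := exists_X_mem_of_monomial_mem hP
      (monomial_mem_colon (nsmul_mem_powerExponents (hadj i) k) f)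
    refine ⟨l, fun h1 => h ?_, hl⟩
    rw [Finsupp.smul_apply, complementExponent_apply, if_pos h1, smul_zero]
  have key : ∀ l, X l ∈ Submodule.colon (complementaryEdgeIdeal K G ^ k) {f} →
      ∀ u ∈ f.support, u + Finsupp.single l 1 ∈ powerExponents G k := by
    intro l hl u hu
    obtain ⟨s, hs, hsu⟩ := exists_le_add_single hl hu
    have h1 : (u + Finsupp.single l 1).degree ≤ s.degree := by
      rw [degree_of_mem_powerExponents hs, map_add, Finsupp.degree_single,
        degree_eq_of_mem_support hf hu]
      omega
    obtain ⟨t, ht⟩ := exists_add_of_le hsu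
    rw [ht, map_add] at h1
    have : t = 0 := (Finsupp.degree_eq_zero_iff t).1 (by omega)
    rw [ht, this, add_zero]
    exact hs
  obtain ⟨e, he⟩ := hG
  induction e with | _ i j
  obtain ⟨x, -, hx⟩ := hex i
  obtain ⟨y, hxy, hy⟩ := hex x
  obtain ⟨u, hu⟩ := support_nonempty.2 (ne_zero_of_isPrime_colon hP)
  have h1 := apply_eq_of_mem_powerExponents hσ (key x hx u hu) x
  have h2 := apply_eq_of_mem_powerExponents hσ (key y hy u hu) x
  simp only [Finset.mem_insert, Finset.mem_singleton, not_or] at hxy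
  have h3 : x ≠ σ x := (hadj x).ne
  simp only [Finsupp.add_apply, Finsupp.single_apply, if_neg h3, if_neg hxy.1, if_neg hxy.2,
    if_true] at h1 h2
  omega

/-- The monomial `f = x_{H^c} · (x_{{i,j}^c})^k` realizes the prime generated by the
variables in `W`: it becomes a member of `I^(k+1)` on multiplication by any of them, while its total
exponent on `W` is `k`, too small for `I^(k+1)`. -/
theorem vNumber_pow_succ_le {G : SimpleGraph (Fin n)} {W H : Finset (Fin n)} (hWH : W ⊆ H)
    (hW : ∀ i j, G.Adj i j → ¬ W ⊆ {i, j})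
    (hH : ∀ w ∈ W, ∃ i j, G.Adj i j ∧ H.erase w ⊆ {i, j})
    {i j : Fin n} (hij : G.Adj i j) (hWij : (W \ {i, j}).card = 1) (k : ℕ) :
    vNumber (complementaryEdgeIdeal K G ^ (k + 1)) ≤ ((n - H.card + (n - 2) * k : ℕ) : EReal) := by
  set φ : Fin n →₀ ℕ := complementExponent H + k • complementExponent {i, j} with hφ
  have hφW : ∑ w ∈ W, φ w = k := by
    simp only [hφ, Finsupp.add_apply, Finset.sum_add_distrib, sum_complementExponent,
      Finset.sdiff_eq_empty_iff_subset.2 hWH, Finset.card_empty, Finsupp.smul_apply,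
      smul_eq_mul, ← Finset.mul_sum, hWij, mul_one, zero_add]
  have hcolon : Submodule.colon (complementaryEdgeIdeal K G ^ (k + 1))
      {(monomial φ 1 : MvPolynomial (Fin n) K)} = Ideal.span (X '' (W : Set (Fin n))) := by
    refine le_antisymm (fun p hp => ?_) (Ideal.span_le.2 ?_)
    · rw [Submodule.mem_colon_singleton, smul_eq_mul] at hp
      rw [mem_ideal_span_X_image]
      intro γ hγ
      obtain ⟨s, hs, hsγ⟩ := mem_complementaryEdgeIdeal_pow.1 hp (γ + φ) (by
        rw [mem_support_iff, coeff_mul_monomial, mul_one]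
        exact mem_support_iff.1 hγ)
      by_contra! h
      have h1 := le_sum_of_mem_powerExponents hW hs
      have h2 : ∑ w ∈ W, s w ≤ ∑ w ∈ W, φ w := Finset.sum_le_sum fun w hw => by
        have := hsγ w
        rwa [Finsupp.add_apply, h w hw, zero_add] at this
      omega
    · rintro _ ⟨w, hw, rfl⟩
      obtain ⟨a, b, hab, hwab⟩ := hH w hw
      rw [SetLike.mem_coe, Submodule.mem_colon_singleton, smul_eq_mul, X, monomial_mul, one_mul,
        monomial_mem_complementaryEdgeIdeal_pow]
      refine ⟨_, ⟨_, nsmul_mem_powerExponents hij k, a, b, hab, rfl⟩, ?_⟩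
      rw [hφ, add_comm, ← add_assoc]
      refine add_le_add ?_ le_rfl
      intro l
      have hl : l ∈ H → l ≠ w → l = a ∨ l = b := fun h1 h2 => by
        simpa using hwab (Finset.mem_erase.2 ⟨h2, h1⟩)
      simp only [Finsupp.add_apply, complementExponent_apply, Finsupp.single_apply,
        Finset.mem_insert, Finset.mem_singleton]
      by_cases h1 : l ∈ H <;> by_cases h2 : l = w
      · simp [h2]; split_ifs <;> simp
      · simp [hl h1 h2]
      · simp [h1]; split_ifs <;> simp
      · simp [h1]; split_ifs <;> simp
  refine vNumber_le (f := monomial φ 1) (isHomogeneous_monomial _ ?_) ?_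
  · rw [hφ, map_add, map_nsmul, degree_complementExponent, degree_complementExponent,
      Finset.card_pair hij.ne, smul_eq_mul, mul_comm]
  · rw [hcolon]
    exact isPrime_span_X_image _

end VNumber

/-! ### Disjoint unions of edges -/

section PerfectMatching

variable {n : ℕ} {G : SimpleGraph (Fin n)} {σ : Fin n → Fin n}

/-- `G` is a disjoint union of edges, and `σ` exchanges the two ends of every edge. -/
def IsPartnerMap (G : SimpleGraph (Fin n)) (σ : Fin n → Fin n) : Prop :=
  ∀ i j, G.Adj i j ↔ j = σ i

namespace IsPartnerMap

theorem adj (h : IsPartnerMap G σ) (l : Fin n) : G.Adj l (σ l) := (h l _).2 rfl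

theorem ne (h : IsPartnerMap G σ) (l : Fin n) : l ≠ σ l := (h.adj l).ne

theorem involutive (h : IsPartnerMap G σ) (l : Fin n) : σ (σ l) = l :=
  ((h _ _).1 (h.adj l).symm).symm

theorem mem_edge_iff (h : IsPartnerMap G σ) (i j l : Fin n) (hij : G.Adj i j) :
    l ∈ ({i, j} : Finset (Fin n)) ↔ σ l ∈ ({i, j} : Finset (Fin n)) := by
  obtain rfl := (h _ _).1 hij
  simp only [Finset.mem_insert, Finset.mem_singleton]
  constructor
  · rintro (rfl | rfl)
    · exact Or.inr rfl
    · exact Or.inl (h.involutive i)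
  · rintro (h1 | h1)
    · exact Or.inr (by rw [← h1, h.involutive])
    · exact Or.inl (by rw [← h.involutive l, h1, h.involutive])

theorem exists_not_mem_edge (hn : 3 ≤ n) (x : Fin n) : ∃ y, y ∉ ({x, σ x} : Finset (Fin n)) := by
  by_contra! hy
  have h1 : (Finset.univ : Finset (Fin n)).card ≤ ({x, σ x} : Finset (Fin n)).card :=
    Finset.card_le_card fun y _ => hy y
  have h2 := Finset.card_le_two (a := x) (b := σ x)
  rw [Finset.card_univ, Fintype.card_fin] at h1
  omega

/-- A vector with equal entries at partners can be recovered from its sum with a unit vector. -/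
theorem eq_of_single_add_eq (h : IsPartnerMap G σ) {s t : Fin n →₀ ℕ} (hs : ∀ l, s l = s (σ l))
    (ht : ∀ l, t l = t (σ l)) {y z : Fin n}
    (hst : Finsupp.single y 1 + s = Finsupp.single z 1 + t) : s = t := by
  by_cases hyz : z = y
  · rw [hyz] at hst
    exact add_left_cancel hst
  · have h1 := DFunLike.congr_fun hst y
    have h2 := DFunLike.congr_fun hst (σ y)
    have h3 := h.ne y
    simp only [Finsupp.add_apply, Finsupp.single_apply, if_true, if_neg hyz, if_neg h3] at h1 h2
    rw [← hs, ← ht] at h2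
    omega

end IsPartnerMap

theorem isPartnerMap_of_iso {t : ℕ} (e : G ≃g copiesK2 t) :
    IsPartnerMap G fun i => e.symm ((e i).1, (e i).2.rev) := by
  intro i j
  rw [← e.map_adj_iff]
  constructor
  · rintro ⟨h1, h2⟩
    have h3 : (e j).2 = (e i).2.rev := by
      generalize (e i).2 = a at *
      generalize (e j).2 = b at *
      revert a b
      decide
    simp [h1, ← h3]
  · rintro rfl
    simp only [RelIso.apply_symm_apply]
    refine ⟨rfl, ?_⟩
    change (e i).2 ≠ (e i).2.rev
    generalize (e i).2 = a
    revert a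
    decide

/-- A graph in which every vertex has exactly one neighbour is a disjoint union of edges: the
smaller ends of the edges number the copies of `K_2`. -/
theorem IsPartnerMap.exists_iso (hn : 3 ≤ n) (h : IsPartnerMap G σ) :
    ∃ t : ℕ, 2 ≤ t ∧ Nonempty (G ≃g copiesK2 t) := by
  classical
  let L := {v : Fin n // v < σ v}
  let e : L ≃ Fin (Fintype.card L) := Fintype.equivFin L
  let f : Fin (Fintype.card L) × Fin 2 → Fin n :=
    fun p => if p.2 = 0 then (e.symm p.1).1 else σ (e.symm p.1).1
  have hflip : ∀ p, σ (f p) = f (p.1, p.2.rev) := by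
    rintro ⟨a, b⟩
    fin_cases b
    · simp [f]
    · simp [f, h.involutive]
  have hinj : Function.Injective f := by
    rintro ⟨a, b⟩ ⟨c, d⟩ hf
    have ha := (e.symm a).2
    have hc := (e.symm c).2
    fin_cases b <;> fin_cases d
    · simp only [f] at hf
      simp [e.symm.injective (Subtype.ext hf)]
    · simp only [f] at hf
      simp only [Fin.mk_one, Fin.isValue, one_ne_zero, if_false, Fin.zero_eta, if_true] at hf
      rw [hf, h.involutive] at ha
      exact absurd ha hc.not_gt
    · simp only [f] at hf
      simp only [Fin.mk_one, Fin.isValue, one_ne_zero, if_false, Fin.zero_eta, if_true] at hf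
      rw [← hf, h.involutive] at hc
      exact absurd hc ha.not_gt
    · simp only [f] at hf
      simp only [Fin.mk_one, Fin.isValue, one_ne_zero, if_false] at hf
      have := congrArg σ hf
      rw [h.involutive, h.involutive] at this
      simp [e.symm.injective (Subtype.ext this)]
  have hsurj : Function.Surjective f := by
    intro v
    rcases lt_or_gt_of_ne (h.ne v) with hv | hv
    · exact ⟨(e ⟨v, hv⟩, 0), by simp [f]⟩
    · exact ⟨(e ⟨σ v, by rwa [h.involutive]⟩, 1), by simp [f, h.involutive]⟩
  let E := Equiv.ofBijective f ⟨hinj, hsurj⟩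
  refine ⟨Fintype.card L, ?_, ⟨(RelIso.symm ⟨E, ?_⟩ : G ≃g copiesK2 _)⟩⟩
  · have := Fintype.card_congr E
    simp only [Fintype.card_prod, Fintype.card_fin] at this
    omega
  · rintro ⟨a, b⟩ ⟨c, d⟩
    change G.Adj (f (a, b)) (f (c, d)) ↔ a = c ∧ b ≠ d
    rw [h, hflip, hinj.eq_iff, Prod.mk.injEq]
    refine and_congr eq_comm ?_
    change d = b.rev ↔ b ≠ d
    revert b d
    decide

/-- A graph that is not a disjoint union of edges has an isolated vertex or a vertex with two
neighbours. -/
theorem exists_isolated_or_two_neighbours (h : ¬ ∃ σ, IsPartnerMap G σ) :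
    (∃ v, ∀ w, ¬ G.Adj v w) ∨ ∃ v a b, G.Adj v a ∧ G.Adj v b ∧ a ≠ b := by
  by_contra! hc
  choose σ hσ using hc.1
  exact h ⟨σ, fun i j => ⟨fun hij => hc.2 i j (σ i) hij (hσ i), fun hj => hj ▸ hσ i⟩⟩

end PerfectMatching

/-! ### The v-number of the powers -/

section VNumberValue

variable {K : Type*} [Field K] {n : ℕ} {G : SimpleGraph (Fin n)}

theorem vNumber_of_partnerMap (hn : 3 ≤ n) {σ : Fin n → Fin n} (h : IsPartnerMap G σ)
    (hG : G.edgeSet.Nonempty) {k : ℕ} (hk : 1 ≤ k) :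
    vNumber (complementaryEdgeIdeal K G ^ k) = (((n - 2) * k : ℕ) : EReal) := by
  refine le_antisymm ?_ (le_vNumber_of_matching h.mem_edge_iff h.adj hG k)
  obtain ⟨k, rfl⟩ := Nat.exists_eq_add_of_le' hk
  -- one end from each of two different edges: the resulting prime is `(x, y)`
  let x : Fin n := ⟨0, by omega⟩
  obtain ⟨y, hy⟩ := IsPartnerMap.exists_not_mem_edge (σ := σ) hn x
  have hyx : y ≠ x := fun h => hy (by simp [h])
  have hcard : ({x, y} \ {x, σ x} : Finset (Fin n)) = {y} := by
    ext l
    simp only [Finset.mem_sdiff, Finset.mem_insert, Finset.mem_singleton] at hy ⊢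
    grind
  have := vNumber_pow_succ_le (K := K) (G := G) (W := {x, y}) (H := {x, y}) subset_rfl ?_ ?_
    (h.adj x) (by rw [hcard, Finset.card_singleton]) k
  · rwa [Finset.card_pair hyx.symm, show n - 2 + (n - 2) * k = (n - 2) * (k + 1) by ring] at this
  · intro i j hij hsub
    obtain rfl := (h _ _).1 hij
    have hx : x ∈ ({i, σ i} : Finset (Fin n)) := hsub (by simp)
    have hy' : y ∈ ({i, σ i} : Finset (Fin n)) := hsub (by simp)
    simp only [Finset.mem_insert, Finset.mem_singleton] at hx hy' hy
    have := h.involutive i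
    grind
  · intro w hw
    refine ⟨_, _, h.adj (if w = x then y else x), ?_⟩
    intro l hl
    simp only [Finset.mem_erase, Finset.mem_insert, Finset.mem_singleton] at hw hl ⊢
    grind

theorem vNumber_of_not_partnerMap (hn : 3 ≤ n) (h : ¬ ∃ σ, IsPartnerMap G σ)
    (hG : G.edgeSet.Nonempty) {k : ℕ} (hk : 1 ≤ k) :
    vNumber (complementaryEdgeIdeal K G ^ k) = (((n - 2) * k - 1 : ℕ) : EReal) := by
  refine le_antisymm ?_ (le_vNumber_complementaryEdgeIdeal_pow hG k)
  obtain ⟨k, rfl⟩ := Nat.exists_eq_add_of_le' hk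
  have hdeg : (n - 2) * (k + 1) - 1 = n - 3 + (n - 2) * k := by
    rw [mul_add, mul_one]
    omega
  rw [hdeg]
  rcases exists_isolated_or_two_neighbours h with ⟨v, hv⟩ | ⟨v, a, b, hva, hvb, hab⟩
  · -- all generators are divisible by the variable of the isolated vertex `v`, and the prime is `(x_v)`
    obtain ⟨e, he⟩ := hG
    induction e with | _ a b
    rw [SimpleGraph.mem_edgeSet] at he
    have hva : v ≠ a := fun h => hv b (h ▸ he)
    have hvb : v ≠ b := fun h => hv a (h ▸ he.symm)
    have := vNumber_pow_succ_le (K := K) (G := G) (W := {v}) (H := {v, a, b}) (by simp) ?_ ?_ he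
      (by simp [Finset.sdiff_eq_filter, Finset.filter_singleton, hva, hvb]) k
    · rwa [Finset.card_eq_three.2 ⟨v, a, b, hva, hvb, he.ne, rfl⟩] at this
    · intro i j hij hsub
      have := hsub (Finset.mem_singleton_self v)
      simp only [Finset.mem_insert, Finset.mem_singleton] at this
      rcases this with rfl | rfl
      · exact hv _ hij
      · exact hv _ hij.symm
    · intro w hw
      obtain rfl := Finset.mem_singleton.1 hw
      exact ⟨a, b, he, by simp [Finset.erase_insert_eq_erase, Finset.erase_subset]⟩
  · -- the prime is generated by `x_a`, `x_b`, and also by `x_v` if `a`, `b`, `v` form a triangle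
    have hva' := hva.ne
    have hvb' := hvb.ne
    have hcard : ({a, b, v} : Finset (Fin n)).card = 3 :=
      Finset.card_eq_three.2 ⟨a, b, v, hab, hva'.symm, hvb'.symm, rfl⟩
    by_cases hadj : G.Adj a b
    · have := vNumber_pow_succ_le (K := K) (G := G) (W := {a, b, v}) (H := {a, b, v}) subset_rfl
        ?_ ?_ hva ?_ k
      · rwa [hcard] at this
      · intro i j hij hsub
        have h1 := Finset.card_le_card hsub
        have h2 := Finset.card_le_two (a := i) (b := j)
        omega
      · intro w hw
        simp only [Finset.mem_insert, Finset.mem_singleton] at hw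
        rcases hw with rfl | rfl | rfl
        · exact ⟨v, b, hvb,
            by intro l; simp only [Finset.mem_erase, Finset.mem_insert, Finset.mem_singleton]; tauto⟩
        · exact ⟨v, a, hva,
            by intro l; simp only [Finset.mem_erase, Finset.mem_insert, Finset.mem_singleton]; tauto⟩
        · exact ⟨a, b, hadj,
            by intro l; simp only [Finset.mem_erase, Finset.mem_insert, Finset.mem_singleton]; tauto⟩
      · rw [Finset.card_eq_one]
        refine ⟨b, ?_⟩
        ext l
        simp only [Finset.mem_sdiff, Finset.mem_insert, Finset.mem_singleton]
        grind
    · have := vNumber_pow_succ_le (K := K) (G := G) (W := {a, b}) (H := {a, b, v})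
        (by intro l; simp only [Finset.mem_insert, Finset.mem_singleton]; tauto) ?_ ?_ hva ?_ k
      · rwa [hcard] at this
      · intro i j hij hsub
        have ha : a ∈ ({i, j} : Finset (Fin n)) := hsub (by simp)
        have hb : b ∈ ({i, j} : Finset (Fin n)) := hsub (by simp)
        simp only [Finset.mem_insert, Finset.mem_singleton] at ha hb
        have := hij.symm
        grind
      · intro w hw
        simp only [Finset.mem_insert, Finset.mem_singleton] at hw
        rcases hw with rfl | rfl
        · exact ⟨v, b, hvb,
            by intro l; simp only [Finset.mem_erase, Finset.mem_insert, Finset.mem_singleton]; tauto⟩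
        · exact ⟨v, a, hva,
            by intro l; simp only [Finset.mem_erase, Finset.mem_insert, Finset.mem_singleton]; tauto⟩
      · rw [Finset.card_eq_one]
        refine ⟨b, ?_⟩
        ext l
        simp only [Finset.mem_sdiff, Finset.mem_insert, Finset.mem_singleton]
        grind

end VNumberValue

/-! ### Graded Betti numbers of the powers -/

section Regularity

variable {K : Type*} [Field K] {n : ℕ}

theorem gradedBetti_deg_ne_zero {I : Ideal (MvPolynomial (Fin n) K)}
    (F : MinimalGradedFreeResolution I) (i : ℕ) (b : Fin (F.rank i)) :
    gradedBetti I i (F.deg i b) ≠ 0 := by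
  have h : Set.encard {a : Fin (F.rank i) | F.deg i a = F.deg i b} ≠ 0 :=
    Set.encard_ne_zero.2 ⟨b, rfl⟩
  intro h0
  exact h (le_zero_iff.1 (h0 ▸ le_iSup (fun F : MinimalGradedFreeResolution I =>
    Set.encard {a : Fin (F.rank i) | F.deg i a = _}) F))

theorem le_regularity {I : Ideal (MvPolynomial (Fin n) K)} {i j : ℕ}
    (h : gradedBetti I i j ≠ 0) : (j : EReal) - (i : EReal) ≤ regularity I :=
  le_iSup_of_le i (le_iSup_of_le j (le_iSup_of_le h le_rfl))

/-- Minimality of the resolution means that no relation between the generators has a unit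
coefficient. -/
theorem MinimalGradedFreeResolution.mem_idealOfVars {I : Ideal (MvPolynomial (Fin n) K)}
    (F : MinimalGradedFreeResolution I) {v : Fin (F.rank 0) → MvPolynomial (Fin n) K}
    (hv : ∑ a, v a * F.gen a = 0) (a : Fin (F.rank 0)) : v a ∈ idealOfVars (Fin n) K := by
  obtain ⟨w, rfl⟩ := (F.exact_zero v).1 (by simpa [Fintype.linearCombination_apply] using hv)
  change ∑ b, F.diff 0 a b * w b ∈ _
  exact Ideal.sum_mem _ fun b _ => Ideal.mul_mem_right _ _ (F.minimal 0 a b)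

theorem MinimalGradedFreeResolution.gen_injective {I : Ideal (MvPolynomial (Fin n) K)}
    (F : MinimalGradedFreeResolution I) : Function.Injective F.gen := by
  intro a b hab
  by_contra hne
  have h := F.mem_idealOfVars (v := Pi.single a 1 - Pi.single b 1)
    (by simp [sub_mul, Finset.sum_sub_distrib, Pi.single_apply, hab]) a
  rw [mem_idealOfVars_iff] at h
  simp [hne] at h

/-- The powers of the complementary edge ideal have a minimal resolution whose generators are
monomials, all of degree `(n - 2) k`. -/
theorem exists_monomial_resolution (K : Type*) [Field K] (G : SimpleGraph (Fin n)) (k : ℕ) :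
    ∃ (F : MinimalGradedFreeResolution (complementaryEdgeIdeal K G ^ k))
      (s : Fin (F.rank 0) → Fin n →₀ ℕ), (∀ a, s a ∈ powerExponents G k) ∧
      (∀ a, F.gen a = monomial (s a) 1) ∧ ∀ a, F.deg 0 a = (n - 2) * k := by
  have hhom : ∀ u ∈ (fun s => monomial s (1 : K)) '' powerExponents G k,
      u.IsHomogeneous ((n - 2) * k) := by
    rintro _ ⟨s, hs, rfl⟩
    exact isHomogeneous_monomial _ (degree_of_mem_powerExponents hs)
  obtain ⟨F, hF, hdeg⟩ := exists_minimalGradedFreeResolution _ _ _ hhom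
    (span_monomial_powerExponents K G k)
  choose s hs hgen using hF
  exact ⟨F, s, hs, fun a => (hgen a).symm, hdeg⟩

theorem MinimalGradedFreeResolution.rank_zero_pos {G : SimpleGraph (Fin n)}
    (hG : G.edgeSet.Nonempty) {k : ℕ}
    (F : MinimalGradedFreeResolution (complementaryEdgeIdeal K G ^ k)) : 0 < F.rank 0 := by
  by_contra h
  have : IsEmpty (Fin (F.rank 0)) := ⟨fun a => h a.pos⟩
  obtain ⟨e, he⟩ := hG
  induction e with | _ i j
  have h1 := (monomial_mem_complementaryEdgeIdeal_pow (K := K)).2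
    ⟨_, nsmul_mem_powerExponents (k := k) he, le_rfl⟩
  rw [← F.span_gen, Set.range_eq_empty, Ideal.span_empty, Ideal.mem_bot, monomial_eq_zero] at h1
  exact one_ne_zero h1

theorem gradedBetti_zero_ne_zero {G : SimpleGraph (Fin n)} (hG : G.edgeSet.Nonempty) (k : ℕ) :
    gradedBetti (complementaryEdgeIdeal K G ^ k) 0 ((n - 2) * k) ≠ 0 := by
  obtain ⟨F, -, -, -, hdeg⟩ := exists_monomial_resolution K G k
  rw [← hdeg ⟨0, F.rank_zero_pos hG⟩]
  exact gradedBetti_deg_ne_zero F 0 _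

theorem exists_eq_single_of_degree_eq_one {u : Fin n →₀ ℕ} (hu : u.degree = 1) :
    ∃ z, u = Finsupp.single z 1 := by
  have h : u ∈ Set.range fun z : Fin n => Finsupp.single z 1 := by
    rw [Finsupp.range_single_one]
    exact hu
  obtain ⟨z, hz⟩ := h
  exact ⟨z, hz.symm⟩

/-- For the disjoint union of at least two edges, the generators of `I^k` have no linear syzygies:
in a product of generators partners have equal exponents, so that a product and a variable are
determined by their product. On the other hand `I^k` is not principal, so there are syzygies. -/
theorem IsPartnerMap.exists_gradedBetti_one_ne_zero (hn : 3 ≤ n) {G : SimpleGraph (Fin n)}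
    {σ : Fin n → Fin n} (h : IsPartnerMap G σ) (hG : G.edgeSet.Nonempty) {k : ℕ} (hk : 1 ≤ k) :
    ∃ j, (n - 2) * k + 2 ≤ j ∧ gradedBetti (complementaryEdgeIdeal K G ^ k) 1 j ≠ 0 := by
  classical
  obtain ⟨F, s, hs, hgen, hdeg⟩ := exists_monomial_resolution K G k
  have hinj : Function.Injective s := fun a b hab => F.gen_injective (by rw [hgen, hgen, hab])
  -- if `I^k` were principal, its single generator would be the `k`-th power of every generator of `I`
  obtain ⟨a, b, hab⟩ : ∃ a b : Fin (F.rank 0), a ≠ b := by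
    by_contra! hall
    let a₀ : Fin (F.rank 0) := ⟨0, F.rank_zero_pos hG⟩
    have hrange : Set.range F.gen = (fun s => monomial s (1 : K)) '' {s a₀} := by
      ext p
      simp only [Set.mem_range, Set.image_singleton, Set.mem_singleton_iff]
      exact ⟨fun ⟨a, ha⟩ => by rw [← ha, hall a a₀, hgen], fun hp => ⟨a₀, by rw [hp, hgen]⟩⟩
    have heq : ∀ i, k • complementExponent {i, σ i} = s a₀ := by
      intro i
      have hmem := nsmul_mem_powerExponents (h.adj i) k
      have h1 := (monomial_mem_complementaryEdgeIdeal_pow (K := K)).2 ⟨_, hmem, le_rfl⟩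
      rw [← F.span_gen, hrange, mem_ideal_span_monomial_image] at h1
      have hle : s a₀ ≤ k • complementExponent {i, σ i} := by
        simpa [support_monomial] using h1
      obtain ⟨t, ht⟩ := exists_add_of_le hle
      have h2 := congrArg Finsupp.degree ht
      rw [map_add, degree_of_mem_powerExponents hmem, degree_of_mem_powerExponents (hs a₀)] at h2
      rw [ht, (Finsupp.degree_eq_zero_iff t).1 (by omega), add_zero]
    let x : Fin n := ⟨0, by omega⟩
    obtain ⟨y, hy⟩ := IsPartnerMap.exists_not_mem_edge (σ := σ) hn x
    have h1 := DFunLike.congr_fun ((heq x).trans (heq y).symm) y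
    rw [Finsupp.smul_apply, Finsupp.smul_apply, complementExponent_apply, complementExponent_apply,
      if_neg hy, if_pos (by simp)] at h1
    simp at h1
    omega
  -- two distinct generators have a Koszul syzygy, so the first differential is nonzero
  obtain ⟨c, d, hcd⟩ : ∃ c d, F.diff 0 c d ≠ 0 := by
    by_contra! hall
    let v : Fin (F.rank 0) → MvPolynomial (Fin n) K :=
      Pi.single a (F.gen b) - Pi.single b (F.gen a)
    obtain ⟨w, hw⟩ := (F.exact_zero v).1 (by
      simp [Fintype.linearCombination_apply, v, sub_mul, Finset.sum_sub_distrib, Pi.single_apply,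
        mul_comm])
    have h1 := congrFun hw a
    have h2 : (F.diff 0).mulVecLin w a = 0 := by
      change ∑ d, F.diff 0 a d * w d = 0
      exact Finset.sum_eq_zero fun d _ => by rw [hall, zero_mul]
    rw [h2] at h1
    simp only [v, Pi.sub_apply, Pi.single_eq_same, Pi.single_eq_of_ne hab, sub_zero, hgen] at h1
    exact one_ne_zero (monomial_eq_zero.1 h1.symm)
  have hrel : ∑ a, F.diff 0 a d * F.gen a = 0 := by
    have h1 := (F.exact_zero ((F.diff 0).mulVecLin (Pi.single d 1))).2 ⟨_, rfl⟩
    simpa [Fintype.linearCombination_apply] using h1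
  refine ⟨F.deg 1 d, ?_, gradedBetti_deg_ne_zero F 1 d⟩
  obtain ⟨m, hm, hhom⟩ := F.diff_homogeneous 0 c d hcd
  rw [hdeg] at hm
  change _ = F.deg 1 d at hm
  -- minimality excludes a constant entry in the column `d`, so only a linear one is left to exclude
  obtain ⟨u, hu⟩ := support_nonempty.2 hcd
  have hum := degree_eq_of_mem_support hhom hu
  by_contra hlt
  have hm0 : m ≠ 0 := by
    rintro rfl
    rw [(Finsupp.degree_eq_zero_iff u).1 hum, mem_support_iff] at hu
    exact hu ((mem_idealOfVars_iff _).1 (F.minimal 0 c d))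
  obtain rfl : m = 1 := by omega
  obtain ⟨z, rfl⟩ := exists_eq_single_of_degree_eq_one hum
  -- the monomial `x_z x^(s c)` occurs in only one summand of the relation
  have hcoeff := congrArg (coeff (Finsupp.single z 1 + s c)) hrel
  rw [coeff_sum, coeff_zero, Finset.sum_eq_single c] at hcoeff
  · rw [hgen, coeff_mul_monomial, mul_one] at hcoeff
    exact mem_support_iff.1 hu hcoeff
  · intro e _ hec
    rw [hgen, coeff_mul_monomial']
    split_ifs with hle
    · by_contra hne
      rw [mul_one] at hne
      have hsupp := mem_support_iff.2 hne
      obtain ⟨m', hm', hhom'⟩ := F.diff_homogeneous 0 e d (support_nonempty.1 ⟨_, hsupp⟩)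
      rw [hdeg] at hm'
      change _ = F.deg 1 d at hm'
      have h1 := degree_eq_of_mem_support hhom' hsupp
      obtain ⟨y, hy⟩ := exists_eq_single_of_degree_eq_one (h1.trans (by omega))
      have h2 := tsub_add_cancel_of_le hle
      rw [hy] at h2
      exact hec (hinj (h.eq_of_single_add_eq (apply_eq_of_mem_powerExponents h.mem_edge_iff (hs e))
        (apply_eq_of_mem_powerExponents h.mem_edge_iff (hs c)) h2))
    · rfl
  · exact fun hc => absurd (Finset.mem_univ c) hc

end Regularity

/-! ### v-number and regularity of the powers -/

theorem mainTheorem6 (K : Type*) [Field K] (n : ℕ) (hn : 3 ≤ n)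
    (G : SimpleGraph (Fin n)) (hG : G.edgeSet.Nonempty) :
    (∀ k : ℕ, 1 ≤ k →
      ((∃ t : ℕ, 2 ≤ t ∧ Nonempty (G ≃g copiesK2 t)) →
        vNumber (complementaryEdgeIdeal K G ^ k) = (((n - 2) * k : ℕ) : EReal)) ∧
      ((¬ ∃ t : ℕ, 2 ≤ t ∧ Nonempty (G ≃g copiesK2 t)) →
        vNumber (complementaryEdgeIdeal K G ^ k) = (((n - 2) * k - 1 : ℕ) : EReal))) ∧
    (∀ k : ℕ, 1 ≤ k →
      vNumber (complementaryEdgeIdeal K G ^ k) < regularity (complementaryEdgeIdeal K G ^ k)) ∧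
    (HasLinearPowers (complementaryEdgeIdeal K G) →
      ∀ k : ℕ, 1 ≤ k →
        vNumber (complementaryEdgeIdeal K G ^ k) =
          regularity (complementaryEdgeIdeal K G ^ k) - 1) := by
  have hpos : ∀ k, 1 ≤ k → 1 ≤ (n - 2) * k := fun k hk => Nat.mul_pos (by omega) hk
  have hreg : ∀ k, (((n - 2) * k : ℕ) : EReal) ≤ regularity (complementaryEdgeIdeal K G ^ k) :=
    fun k => by simpa using le_regularity (gradedBetti_zero_ne_zero (K := K) hG k)
  refine ⟨fun k hk => ⟨?_, ?_⟩, fun k hk => ?_, fun hlin k hk => ?_⟩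
  · rintro ⟨t, -, ⟨e⟩⟩
    exact vNumber_of_partnerMap hn (isPartnerMap_of_iso e) hG hk
  · intro h
    exact vNumber_of_not_partnerMap hn (fun ⟨σ, hσ⟩ => h (hσ.exists_iso hn)) hG hk
  · by_cases h : ∃ σ, IsPartnerMap G σ
    · obtain ⟨σ, hσ⟩ := h
      rw [vNumber_of_partnerMap hn hσ hG hk]
      obtain ⟨j, hj, hβ⟩ := hσ.exists_gradedBetti_one_ne_zero (K := K) hn hG hk
      refine lt_of_lt_of_le ?_ (le_regularity hβ)
      have h1 : ((j : EReal) - ((1 : ℕ) : EReal)) = ((j - 1 : ℕ) : EReal) := by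
        rw [← EReal.coe_coe_eq_natCast, ← EReal.coe_coe_eq_natCast, ← EReal.coe_coe_eq_natCast,
          ← EReal.coe_sub, Nat.cast_sub (by omega)]
      rw [h1, Nat.cast_lt]
      omega
    · rw [vNumber_of_not_partnerMap hn h hG hk]
      refine lt_of_lt_of_le ?_ (hreg k)
      rw [Nat.cast_lt]
      have := hpos k hk
      omega
  · -- a disjoint union of edges has a nonlinear first syzygy already for `k = 1`
    have h : ¬ ∃ σ, IsPartnerMap G σ := by
      rintro ⟨σ, hσ⟩
      obtain ⟨d, hd⟩ := hlin 1 le_rfl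
      obtain ⟨j, hj, hβ⟩ := hσ.exists_gradedBetti_one_ne_zero (K := K) hn hG le_rfl
      have h0 := hd _ _ (gradedBetti_zero_ne_zero hG 1)
      have h1 := hd _ _ hβ
      omega
    have hle : regularity (complementaryEdgeIdeal K G ^ k) ≤ (((n - 2) * k : ℕ) : EReal) := by
      obtain ⟨d, hd⟩ := hlin k hk
      have h0 := hd _ _ (gradedBetti_zero_ne_zero hG k)
      refine iSup_le fun i => iSup_le fun j => iSup_le fun hβ => ?_
      rw [hd i j hβ, h0, ← EReal.coe_coe_eq_natCast, ← EReal.coe_coe_eq_natCast,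
        ← EReal.coe_coe_eq_natCast, ← EReal.coe_sub, EReal.coe_le_coe_iff]
      push_cast
      linarith
    rw [vNumber_of_not_partnerMap hn h hG hk, le_antisymm hle (hreg k),
      ← EReal.coe_coe_eq_natCast, ← EReal.coe_coe_eq_natCast, ← EReal.coe_one, ← EReal.coe_sub,
      Nat.cast_sub (hpos k hk), Nat.cast_one]
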